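/- **Setting.** Let $\Sigma$ be a smooth surface with boundary, and let a collar $(\theta,r)\in S^1\times[0,1)$ be chosen around every boundary component (indexed by $b\in B$), with disjoint open images, so that $\partial\Sigma=\{r=0\}$; each boundary component is thus a circle. Attach half-infinite cylinders to get the open surface $\widehat\Sigma=\Sigma\cup_{\partial\Sigma}(\partial\Sigma\times(-\infty,0])$, whose smooth structure is given by the interior of $\Sigma$ and by the coordinates $(\theta,r)\in S^1\times(-\infty,1)$ near each end. Let $v\,\partial_r$ be a smooth complete vector field on $\mathbb R$ with $v=0$ for $r\ge 0$, $v<0$ for $r<0$ and $v=r/2$ for $r\le -1$, and let $V$ be the vector field on $\widehat\Sigma$ equal to $0$ on $\Sigma$ and to $v(r)\,\partial_r$ on the ends. The *convex completion* $T^*_c\Sigma$ is the exact symplectic manifold $T^*\widehat\Sigma$ with Liouville form $\lambda=\lambda_{\mathrm{can}}-d\langle p,V\rangle$. Over $\Sigma$ this is $\lambda_{\mathrm{can}}$, with unchanged Liouville field $p\,\partial_p$; over the part $r\le-1$ of an end, with coordinates $(\theta,p,r,\xi)$ on $T^*S^1\times T^*(-\infty,0)$, it is $p\,d\theta+\tfrac12(\xi\,dr-r\,d\xi)$,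 that is, a convex end $T^*\partial\Sigma\times\mathbb C_{\mathrm{Re}\le 0}$ has been attached to the sectorial boundary of $T^*\Sigma$. The *ideal boundary* $\partial_\infty T^*_c\Sigma$ is the space of orbits of the Liouville flow in the complement of the skeleton, which is the zero section over $\Sigma$. Over $\Sigma$ the flow scales covectors, so $\partial_\infty T^*_c\Sigma$ contains $T^\infty\Sigma=(T^*\Sigma\setminus 0)/\mathbb R_{>0}$. A *Legendrian isotopy* between two subsets of $\partial_\infty T^*_c\Sigma$ is a family of Legendrian embeddings $S^1\to\partial_\infty T^*_c\Sigma$, $t\in[0,1]$, with image the first set at $t=0$ and the second at $t=1$, which is smooth in the sense that it lifts to a smooth map $[0,1]\times S^1\to T^*_c\Sigma$ (Legendrian: $\lambda$ vanishes on the lift at each time; embedding: injective as a map to the space of orbits, and with differential injective modulo the Liouville direction). **Lemma.** Let $\gamma:S^1\to\Sigma$ be a smooth regular injective parametrization of a boundary component, and let $n$ be a continuous vector field along $\gamma$ transverse to $\gamma$. Let $$\Lambda_\pm=\{(q,[p])\in T^\infty\Sigma : q=\gamma(\theta)\text{ for some }\theta,\ p(\dot\gamma(\theta))=0,\ \pm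 p(n(\theta))>0\}$$ be the Legendrian lifts of $\gamma$ for its two coorientations. Then, for all choices of collars and of $v$, $\Lambda_+$ is Legendrian isotopic to $\Lambda_-$ in $\partial_\infty T^*_c\Sigma$. -/

import Mathlib

open Set
open scoped Manifold ContDiff

namespace Coorientation

/-- The cotangent bundle of a manifold `N`, as a manifold. -/
abbrev CotangentBundle {E H : Type*} [NormedAddCommGroup E] [NormedSpace ℝ E] [TopologicalSpace H]
    (I : ModelWithCorners ℝ E H) (N : Type*) [TopologicalSpace N] [ChartedSpace H N] : Type _ :=
  Bundle.TotalSpace (E →L[ℝ] ℝ) (fun x : N => TangentSpace I x →L[ℝ] ℝ)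

/-- The model with corners of the cotangent bundle of a surface without boundary. -/
noncomputable abbrev cotangentModel := (𝓡 2).prod 𝓘(ℝ, EuclideanSpace ℝ (Fin 2) →L[ℝ] ℝ)

/-- The model with corners of the cylinder `S¹ × ℝ`. -/
noncomputable abbrev cylModel := (𝓡 1).prod 𝓘(ℝ, ℝ)

section Surface

variable (M : Type*) [TopologicalSpace M] [ChartedSpace (EuclideanHalfSpace 2) M]

/-- A collar `(θ, r) ∈ S¹ × [0, 1)` around every boundary component of the surface `M`; the
components are indexed by `B`, and `r = 0` is the boundary. -/
structure BoundaryCollar (B : Type*) where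
  chart : B → PartialEquiv (Circle × ℝ) M
  source_eq : ∀ b, (chart b).source = univ ×ˢ Ico (0 : ℝ) 1
  isOpen_target : ∀ b, IsOpen (chart b).target
  disjoint : ∀ b b', b ≠ b' → Disjoint (chart b).target (chart b').target
  smooth : ∀ b, ContMDiffOn cylModel (𝓡∂ 2) ∞ (chart b) (univ ×ˢ Ico (0 : ℝ) 1)
  smooth_symm : ∀ b, ContMDiffOn (𝓡∂ 2) cylModel ∞ (chart b).symm (chart b).target
  boundary_eq : (𝓡∂ 2).boundary M = ⋃ b, chart b '' (univ ×ˢ {(0 : ℝ)})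

end Surface

/-! ### The surface `M ∪ ∂M × (-∞, 0]` -/

section Extension

variable {M : Type*} [TopologicalSpace M] [ChartedSpace (EuclideanHalfSpace 2) M] {B : Type*}

/-- The open surface `M ∪ (∂M × (-∞, 0])`, as a set: the points of `M`, and the
points `(θ, r)`, `r < 0`, of the half-infinite cylinder attached to the boundary component `b`. -/
inductive Extension (c : BoundaryCollar M B) : Type _
  | ofSurface (x : M) : Extension c
  | ofEnd (b : B) (θ : Circle) (r : Iio (0 : ℝ)) : Extension c

namespace Extension

variable {c : BoundaryCollar M B}

variable (c) in
/-- The cylinder `S¹ × ℝ`, of which the part `r < 1` is mapped to the end attached at `b` together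
with the collar of `b`. -/
noncomputable def cylMap (b : B) (z : Circle × ℝ) : Extension c :=
  if h : z.2 < 0 then ofEnd b z.1 ⟨z.2, h⟩ else ofSurface (c.chart b z)

variable (c) in
/-- The interior of `M` as a patch of the extended surface. -/
noncomputable def interiorPatch : PartialEquiv (Extension c) M where
  toFun
    | ofSurface x => x
    | ofEnd b θ _ => c.chart b (θ, 0)
  invFun := ofSurface
  source := {y | ∃ x ∈ (𝓡∂ 2).interior M, y = ofSurface x}
  target := (𝓡∂ 2).interior M
  map_source' := by rintro _ ⟨x, hx, rfl⟩; exact hx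
  map_target' := fun x hx => ⟨x, hx, rfl⟩
  left_inv' := by rintro _ ⟨x, hx, rfl⟩; rfl
  right_inv' := fun _ _ => rfl

variable (c) in
/-- The end attached at `b` together with the collar of `b`, as a patch `S¹ × (-∞, 1)`. -/
noncomputable def endPatch (b : B) : PartialEquiv (Extension c) (Circle × ℝ) where
  toFun
    | ofSurface x => (c.chart b).symm x
    | ofEnd _ θ r => (θ, r)
  invFun := cylMap c b
  source := {y | (∃ x ∈ (c.chart b).target, y = ofSurface x) ∨ ∃ θ r, y = ofEnd b θ r}
  target := univ ×ˢ Iio (1 : ℝ)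
  map_source' := by
    rintro _ (⟨x, hx, rfl⟩ | ⟨θ, r, rfl⟩)
    · have := (c.chart b).map_target hx
      rw [c.source_eq] at this
      exact ⟨trivial, this.2.2⟩
    · have : (r : ℝ) < 1 := lt_trans r.2 one_pos
      exact ⟨trivial, this⟩
  map_target' := by
    rintro ⟨θ, r⟩ ⟨-, hr⟩
    by_cases h : r < 0
    · exact Or.inr ⟨θ, ⟨r, h⟩, by simp [cylMap, h]⟩
    · refine Or.inl ⟨c.chart b (θ, r), (c.chart b).map_source ?_, by simp [cylMap, h]⟩
      rw [c.source_eq]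
      exact ⟨trivial, not_lt.1 h, hr⟩
  left_inv' := by
    rintro _ (⟨x, hx, rfl⟩ | ⟨θ, r, rfl⟩)
    · have := (c.chart b).map_target hx
      rw [c.source_eq] at this
      have h0 : ¬ ((c.chart b).symm x).2 < 0 := not_lt.2 this.2.1
      simp [cylMap, h0, (c.chart b).right_inv hx]
    · have : (r : ℝ) < 0 := r.2
      simp [cylMap, this]
  right_inv' := by
    rintro ⟨θ, r⟩ ⟨-, hr⟩
    by_cases h : r < 0
    · simp [cylMap, h]
    · have : (θ, r) ∈ (c.chart b).source := by
        rw [c.source_eq]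
        exact ⟨trivial, not_lt.1 h, hr⟩
      simp [cylMap, h, (c.chart b).left_inv this]

/-- The linear identification `ℝ¹ × ℝ = ℝ²`. -/
noncomputable def planeEquiv : (EuclideanSpace ℝ (Fin 1) × ℝ) ≃L[ℝ] EuclideanSpace ℝ (Fin 2) :=
  ContinuousLinearEquiv.ofFinrankEq (by simp)

/-- A patch `P` with values in a manifold `N`, followed by the chart of `N` around `x` and a linear
identification of its model space with the plane. -/
noncomputable def patchChart {E H N : Type*} [NormedAddCommGroup E] [NormedSpace ℝ E]
    [TopologicalSpace H] [TopologicalSpace N] [ChartedSpace H N] (I : ModelWithCorners ℝ E H)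
    (P : PartialEquiv (Extension c) N) (L : E ≃L[ℝ] EuclideanSpace ℝ (Fin 2)) (x : N) :
    PartialEquiv (Extension c) (EuclideanSpace ℝ (Fin 2)) :=
  (P.trans (extChartAt I x)).trans L.toEquiv.toPartialEquiv

variable (c) in
/-- The chart of the extended surface given by the chart of `M` around `x`, on the interior. -/
noncomputable def interiorChart (x : M) :
    PartialEquiv (Extension c) (EuclideanSpace ℝ (Fin 2)) :=
  patchChart (𝓡∂ 2) (interiorPatch c) (.refl ℝ _) x

variable (c) in
/-- The chart of the extended surface given by the coordinates `(θ, r)` near an end. -/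
noncomputable def endChart (b : B) (z : Circle × ℝ) :
    PartialEquiv (Extension c) (EuclideanSpace ℝ (Fin 2)) :=
  patchChart cylModel (endPatch c b) planeEquiv z

variable (c) in
/-- The charts of the extended surface. -/
def charts : Set (PartialEquiv (Extension c) (EuclideanSpace ℝ (Fin 2))) :=
  range (interiorChart c) ∪ range (fun z : B × (Circle × ℝ) => endChart c z.1 z.2)

/-- Smooth compatibility of two charts. -/
def Compatible (e e' : PartialEquiv (Extension c) (EuclideanSpace ℝ (Fin 2))) : Prop :=
  IsOpen (e.symm.trans e').source ∧ ContDiffOn ℝ ∞ (e.symm.trans e') (e.symm.trans e').source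

theorem isOpen_extChartAt_preimage_of_interior {E H N : Type*} [NormedAddCommGroup E]
    [NormedSpace ℝ E] [TopologicalSpace H] [TopologicalSpace N] [ChartedSpace H N]
    (I : ModelWithCorners ℝ E H) [IsManifold I ∞ N] (x : N) {O : Set N} (hO : IsOpen O)
    (h : O ⊆ I.interior N) :
    IsOpen ((extChartAt I x).target ∩ (extChartAt I x).symm ⁻¹' O) := by
  have key : (extChartAt I x).target ∩ (extChartAt I x).symm ⁻¹' O =
      interior (extChartAt I x).target ∩ (extChartAt I x).symm ⁻¹' O := by
    ext z
    refine ⟨fun ⟨hz, hzO⟩ => ⟨?_, hzO⟩, fun ⟨hz, hzO⟩ => ⟨interior_subset hz, hzO⟩⟩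
    have hs : (extChartAt I x).symm z ∈ (chartAt H x).source := by
      rw [← extChartAt_source I]
      exact (extChartAt I x).map_target hz
    have := (I.isInteriorPoint_iff_of_mem_atlas (n := ∞) (by simp) (chart_mem_atlas H x) hs).1
      (h hzO)
    have h2 : (extChartAt I x) ((extChartAt I x).symm z) ∈ interior (extChartAt I x).target := this
    rwa [(extChartAt I x).right_inv hz] at h2
  rw [key]
  exact ((continuousOn_extChartAt_symm x).mono interior_subset).isOpen_inter_preimage
    isOpen_interior hO

theorem compatible_patchChart {E H N E' H' N' : Type*}
    [NormedAddCommGroup E] [NormedSpace ℝ E]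
    [TopologicalSpace H] [TopologicalSpace N] [ChartedSpace H N] (I : ModelWithCorners ℝ E H)
    [IsManifold I ∞ N] [NormedAddCommGroup E'] [NormedSpace ℝ E']
    [TopologicalSpace H'] [TopologicalSpace N'] [ChartedSpace H' N']
    (I' : ModelWithCorners ℝ E' H') [IsManifold I' ∞ N']
    (P : PartialEquiv (Extension c) N) (L : E ≃L[ℝ] EuclideanSpace ℝ (Fin 2)) (x : N)
    (P' : PartialEquiv (Extension c) N') (L' : E' ≃L[ℝ] EuclideanSpace ℝ (Fin 2)) (x' : N')
    (hO : IsOpen (P.symm.trans P').source) (hint : (P.symm.trans P').source ⊆ I.interior N)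
    (hs : ContMDiffOn I I' ∞ (P.symm.trans P') (P.symm.trans P').source) :
    Compatible (patchChart I P L x) (patchChart I' P' L' x') := by
  set O := (P.symm.trans P').source with hOdef
  set g := P.symm.trans P' with hg
  set S : Set E := (extChartAt I x).target ∩
    (extChartAt I x).symm ⁻¹' (O ∩ g ⁻¹' (extChartAt I' x').source) with hS
  have hO' : IsOpen (O ∩ g ⁻¹' (extChartAt I' x').source) :=
    hs.continuousOn.isOpen_inter_preimage hO (isOpen_extChartAt_source x')
  have hSopen : IsOpen S := isOpen_extChartAt_preimage_of_interior I x hO'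
    (inter_subset_left.trans hint)
  have hsource : ((patchChart I P L x).symm.trans (patchChart I' P' L' x')).source =
      L.symm ⁻¹' S := by
    ext z
    have hL : (L.toEquiv.symm : EuclideanSpace ℝ (Fin 2) → E) = L.symm := rfl
    simp only [patchChart, hS, hOdef, hg, PartialEquiv.trans_source, PartialEquiv.symm_source,
      PartialEquiv.trans_target, mem_inter_iff, mem_preimage, PartialEquiv.coe_trans,
      PartialEquiv.coe_trans_symm, Function.comp_apply,
      Equiv.toPartialEquiv_source, Equiv.toPartialEquiv_target, mem_univ,
      Equiv.toPartialEquiv_symm_apply, and_true, true_and, hL]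
    tauto
  refine ⟨?_, ?_⟩
  · rw [hsource]
    exact hSopen.preimage L.symm.continuous
  · rw [hsource]
    have h1 : ContDiffOn ℝ ∞ (extChartAt I' x' ∘ g ∘ (extChartAt I x).symm) S := by
      rw [← contMDiffOn_iff_contDiffOn]
      refine (contMDiffOn_extChartAt (I := I') (x := x')).comp
        (hs.comp (t := O) ((contMDiffOn_extChartAt_symm x).mono inter_subset_left) ?_) ?_
      · exact fun z hz => hz.2.1
      · intro z hz
        have := hz.2.2
        rwa [mem_preimage, extChartAt_source] at this
    exact L'.contDiff.comp_contDiffOn (h1.comp L.symm.contDiff.contDiffOn fun _ h => h)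

theorem chart_mem_interior_iff (b : B) (z : Circle × ℝ) (hz : z ∈ (c.chart b).source) :
    c.chart b z ∈ (𝓡∂ 2).interior M ↔ 0 < z.2 := by
  have hz' := hz
  rw [c.source_eq] at hz'
  rw [← ModelWithCorners.compl_boundary, mem_compl_iff, c.boundary_eq, mem_iUnion]
  constructor
  · intro h
    refine lt_of_le_of_ne hz'.2.1 fun h0 => h ⟨b, z, ⟨trivial, h0.symm⟩, rfl⟩
  · rintro h ⟨b', w, ⟨-, hw⟩, hwz⟩
    have hw' : w ∈ (c.chart b').source := by
      rw [c.source_eq]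
      have : w.2 = 0 := hw
      exact ⟨trivial, by simp [this]⟩
    by_cases hb : b = b'
    · subst hb
      have := (c.chart b).injOn hw' hz hwz
      rw [← this] at h
      exact h.ne' hw
    · exact (c.disjoint b b' hb).le_bot ⟨(c.chart b).map_source hz, hwz ▸ (c.chart b').map_source hw'⟩

variable (c) in
open Classical in
/-- The preferred chart at a point of the extended surface. -/
noncomputable def preferredChart (y : Extension c) :
    PartialEquiv (Extension c) (EuclideanSpace ℝ (Fin 2)) :=
  match y with
  | ofSurface x =>
    if h : ∃ b, x ∈ (c.chart b).target then endChart c h.choose ((c.chart h.choose).symm x)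
    else interiorChart c x
  | ofEnd b θ r => endChart c b (θ, r)

theorem preferredChart_mem (y : Extension c) : preferredChart c y ∈ charts c := by
  rcases y with x | ⟨b, θ, r⟩
  · by_cases h : ∃ b, x ∈ (c.chart b).target
    · simp only [preferredChart, h, dite_true]
      exact Or.inr ⟨(_, _), rfl⟩
    · simp only [preferredChart, h, dite_false]
      exact Or.inl ⟨x, rfl⟩
  · exact Or.inr ⟨(b, (θ, r)), rfl⟩

theorem mem_preferredChart_source (y : Extension c) : y ∈ (preferredChart c y).source := by
  rcases y with x | ⟨b, θ, r⟩
  · by_cases h : ∃ b, x ∈ (c.chart b).target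
    · simp only [preferredChart, h, dite_true, endChart, patchChart, PartialEquiv.trans_source,
        Equiv.toPartialEquiv_source, preimage_univ, inter_univ]
      exact ⟨Or.inl ⟨x, h.choose_spec, rfl⟩, mem_extChartAt_source (I := cylModel) _⟩
    · simp only [preferredChart, h, dite_false, interiorChart, patchChart,
        PartialEquiv.trans_source, Equiv.toPartialEquiv_source, preimage_univ, inter_univ]
      refine ⟨⟨x, ?_, rfl⟩, mem_extChartAt_source (I := 𝓡∂ 2) _⟩
      rw [← ModelWithCorners.compl_boundary, mem_compl_iff, c.boundary_eq, mem_iUnion]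
      rintro ⟨b, z, ⟨-, hz⟩, rfl⟩
      refine h ⟨b, (c.chart b).map_source ?_⟩
      rw [c.source_eq]
      have : z.2 = 0 := hz
      exact ⟨trivial, by simp [this]⟩
  · simp only [preferredChart, endChart, patchChart, PartialEquiv.trans_source,
      Equiv.toPartialEquiv_source, preimage_univ, inter_univ]
    exact ⟨Or.inr ⟨θ, r, rfl⟩, mem_extChartAt_source (I := cylModel) _⟩

variable [IsManifold (𝓡∂ 2) ∞ M]

theorem compatible_of_mem_charts {e e' : PartialEquiv (Extension c) (EuclideanSpace ℝ (Fin 2))}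
    (he : e ∈ charts c) (he' : e' ∈ charts c) : Compatible e e' := by
  have hopen : IsOpen ((𝓡∂ 2).interior M) := ModelWithCorners.isOpen_interior (n := ∞) (by simp)
  have hcyl : ∀ s : Set (Circle × ℝ), s ⊆ cylModel.interior (Circle × ℝ) := fun s => by
    rw [ModelWithCorners.interior_eq_univ]
    exact subset_univ s
  rcases he with ⟨x, rfl⟩ | ⟨⟨b, x⟩, rfl⟩ <;> rcases he' with ⟨x', rfl⟩ | ⟨⟨b', x'⟩, rfl⟩
  · have hsrc : ((interiorPatch c).symm.trans (interiorPatch c)).source =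
        (𝓡∂ 2).interior M := by
      ext y
      simp [PartialEquiv.trans_source, interiorPatch]
    refine compatible_patchChart _ _ _ _ _ _ _ _ ?_ ?_ ?_
    · rwa [hsrc]
    · rw [hsrc]
    · exact contMDiffOn_id
  · have hsrc : ((interiorPatch c).symm.trans (endPatch c b')).source =
        (𝓡∂ 2).interior M ∩ (c.chart b').target := by
      ext y
      simp [PartialEquiv.trans_source, interiorPatch, endPatch]
    refine compatible_patchChart _ _ _ _ _ _ _ _ ?_ ?_ ?_
    · rw [hsrc]
      exact hopen.inter (c.isOpen_target b')
    · rw [hsrc]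
      exact inter_subset_left
    · rw [hsrc]
      exact (c.smooth_symm b').mono inter_subset_right
  · have hsrc : ((endPatch c b).symm.trans (interiorPatch c)).source =
        univ ×ˢ Ioo (0 : ℝ) 1 := by
      ext ⟨θ, r⟩
      simp only [PartialEquiv.trans_source, PartialEquiv.symm_source, mem_inter_iff, mem_preimage]
      constructor
      · rintro ⟨⟨-, h1⟩, y, hy, hyz⟩
        by_cases h : r < 0
        · simp [endPatch, cylMap, h] at hyz
        · have hm : (θ, r) ∈ (c.chart b).source := by
            rw [c.source_eq]
            exact ⟨trivial, not_lt.1 h, h1⟩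
          have hyz' : c.chart b (θ, r) = y := by simpa [endPatch, cylMap, h] using hyz
          exact ⟨trivial, (chart_mem_interior_iff b _ hm).1 (hyz' ▸ hy), h1⟩
      · rintro ⟨-, h0, h1⟩
        have h0' : (0 : ℝ) < r := h0
        have hm : (θ, r) ∈ (c.chart b).source := by
          rw [c.source_eq]
          exact ⟨trivial, h0'.le, h1⟩
        exact ⟨⟨trivial, h1⟩, _, (chart_mem_interior_iff b _ hm).2 h0', by
          simp [endPatch, cylMap, h0'.not_gt]⟩
    refine compatible_patchChart _ _ _ _ _ _ _ _ ?_ (hcyl _) ?_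
    · rw [hsrc]
      exact isOpen_univ.prod isOpen_Ioo
    · rw [hsrc]
      refine ((c.smooth b).mono (prod_mono_right Ioo_subset_Ico_self)).congr ?_
      rintro ⟨θ, r⟩ ⟨-, h0, -⟩
      have h0' : (0 : ℝ) < r := h0
      simp [endPatch, interiorPatch, cylMap, h0'.not_gt]
  · by_cases hb : b = b'
    · subst hb
      have hsrc : ((endPatch c b).symm.trans (endPatch c b)).source = univ ×ˢ Iio (1 : ℝ) := by
        rw [PartialEquiv.trans_source, PartialEquiv.symm_source]
        exact inter_eq_left.2 (endPatch c b).target_subset_preimage_source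
      refine compatible_patchChart _ _ _ _ _ _ _ _ ?_ (hcyl _) ?_
      · rw [hsrc]
        exact isOpen_univ.prod isOpen_Iio
      · rw [hsrc]
        exact contMDiffOn_id.congr fun z hz => (endPatch c b).right_inv hz
    · have hsrc : ((endPatch c b).symm.trans (endPatch c b')).source = ∅ := by
        rw [eq_empty_iff_forall_notMem]
        rintro z ⟨hz, hz'⟩
        have h1 := (endPatch c b).map_target hz
        rcases h1 with ⟨y, hy, hyz⟩ | ⟨θ, r, hyz⟩ <;>
          rcases hz' with ⟨y', hy', hyz'⟩ | ⟨θ', r', hyz'⟩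
        · have : y = y' := by
            have := hyz.symm.trans hyz'
            simpa using this
          exact (c.disjoint b b' hb).le_bot ⟨hy, this ▸ hy'⟩
        · have := hyz.symm.trans hyz'
          simp at this
        · have := hyz.symm.trans hyz'
          simp at this
        · have := hyz.symm.trans hyz'
          simp only [ofEnd.injEq] at this
          exact hb this.1
      refine compatible_patchChart _ _ _ _ _ _ _ _ ?_ (hcyl _) ?_
      · rw [hsrc]
        exact isOpen_empty
      · rw [hsrc]
        exact fun _ h => h.elim

variable (c) in
/-- The charts of the extended surface define its topology and its smooth structure. -/
noncomputable def chartedSpaceCore :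
    ChartedSpaceCore (EuclideanSpace ℝ (Fin 2)) (Extension c) where
  atlas := charts c
  chartAt := preferredChart c
  mem_chart_source := mem_preferredChart_source
  chart_mem_atlas := preferredChart_mem
  open_source _ _ he he' := (compatible_of_mem_charts he he').1
  continuousOn_toFun _ _ he he' := (compatible_of_mem_charts he he').2.continuousOn

noncomputable instance : TopologicalSpace (Extension c) := (chartedSpaceCore c).toTopologicalSpace

noncomputable instance : ChartedSpace (EuclideanSpace ℝ (Fin 2)) (Extension c) :=
  (chartedSpaceCore c).toChartedSpace

instance : IsManifold (𝓡 2) ∞ (Extension c) := by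
  refine isManifold_of_contDiffOn _ _ _ fun e e' he he' => ?_
  obtain ⟨f, hf, rfl⟩ := mem_iUnion₂.1 he
  obtain ⟨f', hf', rfl⟩ := mem_iUnion₂.1 he'
  exact (compatible_of_mem_charts hf hf').2.mono inter_subset_left

variable (c) in
/-- The derivative of the inclusion of `M` into the extended surface. -/
noncomputable def dInclusion (x : M) :
    TangentSpace (𝓡∂ 2) x →L[ℝ] TangentSpace (𝓡 2) (ofSurface x : Extension c) :=
  mfderiv (𝓡∂ 2) (𝓡 2) (ofSurface : M → Extension c) x

end Extension
end Extension

/-! ### The Liouville structure of the convex completion -/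

/-- A complete vector field `v ∂_r` on the line, given by its flow, which vanishes for `r ≥ 0`, is
negative for `r < 0`, and is equal to `(r / 2) ∂_r` for `r ≤ -1`. -/
structure EndFlow where
  flow : ℝ → ℝ → ℝ
  smooth : ContDiff ℝ ∞ fun z : ℝ × ℝ => flow z.1 z.2
  flow_zero : ∀ r, flow 0 r = r
  flow_add : ∀ s t r, flow (s + t) r = flow s (flow t r)
  fixed : ∀ t r, 0 ≤ r → flow t r = r
  neg : ∀ r, r < 0 → deriv (fun t => flow t r) 0 < 0
  radial : ∀ r, r ≤ -1 → deriv (fun t => flow t r) 0 = r / 2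

theorem EndFlow.flow_neg (f : EndFlow) (t : ℝ) {r : ℝ} (hr : r < 0) : f.flow t r < 0 := by
  by_contra h
  have h1 := f.fixed (-t) _ (not_lt.1 h)
  rw [← f.flow_add, neg_add_cancel, f.flow_zero] at h1
  exact h (h1 ▸ hr)

section Completion

variable {M : Type*} [TopologicalSpace M] [ChartedSpace (EuclideanHalfSpace 2) M]
  [IsManifold (𝓡∂ 2) ∞ M] {B : Type*} (c : BoundaryCollar M B) (f : EndFlow)

/-- The flow on the extended surface of the vector field `V` which is `v ∂_r` on the ends and `0`
on `M`. -/
def baseFlow (t : ℝ) : Extension c → Extension c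
  | .ofSurface x => .ofSurface x
  | .ofEnd b θ r => .ofEnd b θ ⟨f.flow t r, f.flow_neg t r.2⟩

/-- The vector field `V` on the extended surface, the velocity of `baseFlow`. -/
noncomputable def baseField (y : Extension c) : TangentSpace (𝓡 2) y :=
  (mfderiv 𝓘(ℝ, ℝ) (𝓡 2) (fun t => baseFlow c f t y) 0 (1 : ℝ) : EuclideanSpace ℝ (Fin 2))

/-- The cotangent bundle of the extended surface, which is the manifold underlying the convex
completion: over the end at `b` it is `T*S¹ × T*(-∞, 0)`. -/
abbrev Completion : Type _ := CotangentBundle (𝓡 2) (Extension c)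

/-- The canonical Liouville form `λ_can = p dq` of the cotangent bundle. -/
noncomputable def canonicalForm (x : Completion c) : TangentSpace cotangentModel x →L[ℝ] ℝ :=
  x.2.comp (mfderiv cotangentModel (𝓡 2) (Bundle.TotalSpace.proj : Completion c → Extension c) x)

/-- The function `⟨p, V⟩` on the cotangent bundle. -/
noncomputable def momentum (x : Completion c) : ℝ := x.2 (baseField c f x.proj)

/-- The differential of `momentum`. -/
noncomputable def dMomentum (x : Completion c) : TangentSpace cotangentModel x →L[ℝ] ℝ :=
  mfderiv cotangentModel 𝓘(ℝ, ℝ) (momentum c f) x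

/-- The Liouville form `λ = λ_can - d⟨p, V⟩`. It is `λ_can` over `M`, and it is
`p dθ + (ξ dr - r dξ) / 2` over the part `r ≤ -1` of an end. -/
noncomputable def liouvilleForm (x : Completion c) : TangentSpace cotangentModel x →L[ℝ] ℝ :=
  canonicalForm c x - dMomentum c f x

/-- The flow of the Liouville vector field of `λ`. As `V` is the velocity of `baseFlow`, the vector
field `Z` with `ι_Z dλ = λ` is the sum of the fibrewise dilation `p ∂_p` and of the cotangent lift
of `V`, so its flow is the cotangent lift of `baseFlow` scaled by `exp t`. -/
noncomputable def liouvilleFlow (t : ℝ) (x : Completion c) : Completion c :=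
  ⟨baseFlow c f t x.proj,
    Real.exp t • x.2.comp (mfderiv (𝓡 2) (𝓡 2) (baseFlow c f t) x.proj).inverse⟩

/-- The Liouville vector field, the velocity of `liouvilleFlow`. -/
noncomputable def liouvilleField (x : Completion c) : TangentSpace cotangentModel x :=
  (mfderiv 𝓘(ℝ, ℝ) cotangentModel (fun t => liouvilleFlow c f t x) 0 (1 : ℝ) :
    EuclideanSpace ℝ (Fin 2) × (EuclideanSpace ℝ (Fin 2) →L[ℝ] ℝ))

/-- The points which do not escape to infinity under the Liouville flow: the zero section over the
original surface `M`. -/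
def skeleton : Set (Completion c) :=
  {x | (∃ q : M, x.proj = .ofSurface q) ∧ x.2 = 0}

/-- The points which escape to infinity under the Liouville flow. -/
abbrev Escaping : Type _ := {x : Completion c // x ∉ skeleton c}

/-- The ideal boundary: the space of the Liouville orbits which escape to infinity. -/
def IdealBoundary : Type _ :=
  Quot fun x y : Escaping c => ∃ t : ℝ, liouvilleFlow c f t x.1 = y.1

/-- The orbit of a point. -/
def toIdealBoundary (x : Escaping c) : IdealBoundary c f := Quot.mk _ x

/-- A family of points of the convex completion which represents a Legendrian embedding of the
circle into the ideal boundary: a smooth lift of the embedding, on which `λ` vanishes; the map to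
the space of orbits is injective, and it is an immersion since no nonzero tangent vector of the lift
is tangent to the orbit. -/
structure IsLegendrianEmbedding (ℓ : Circle → Escaping c) : Prop where
  smooth : ContMDiff (𝓡 1) cotangentModel ∞ fun θ => (ℓ θ).1
  injective : Function.Injective fun θ => toIdealBoundary c f (ℓ θ)
  immersive : ∀ (θ : Circle) (u : TangentSpace (𝓡 1) θ) (a : ℝ),
    mfderiv (𝓡 1) cotangentModel (fun θ => (ℓ θ).1) θ u = a • liouvilleField c f (ℓ θ).1 → u = 0
  legendrian : ∀ (θ : Circle) (u : TangentSpace (𝓡 1) θ),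
    liouvilleForm c f (ℓ θ).1 (mfderiv (𝓡 1) cotangentModel (fun θ => (ℓ θ).1) θ u) = 0

/-- Two subsets of the ideal boundary are Legendrian isotopic knots: they are the images of the two
ends of a smooth family of Legendrian embeddings of the circle. -/
def LegendrianIsotopic (Λ Λ' : Set (IdealBoundary c f)) : Prop :=
  ∃ L : ℝ × Circle → Escaping c,
    ContMDiffOn (𝓘(ℝ, ℝ).prod (𝓡 1)) cotangentModel ∞ (fun z => (L z).1)
      (Icc (0 : ℝ) 1 ×ˢ univ) ∧
    (∀ t ∈ Icc (0 : ℝ) 1, IsLegendrianEmbedding c f fun θ => L (t, θ)) ∧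
    range (fun θ => toIdealBoundary c f (L (0, θ))) = Λ ∧
    range (fun θ => toIdealBoundary c f (L (1, θ))) = Λ'

end Completion

/-! ### Curves on the surface and their Legendrian lifts -/

section Curves

variable {M : Type*} [TopologicalSpace M] [ChartedSpace (EuclideanHalfSpace 2) M]
  [IsManifold (𝓡∂ 2) ∞ M] {B : Type*} (c : BoundaryCollar M B) (f : EndFlow)

/-- `γ` is a smooth regular parametrization of a component of the boundary of `M`. -/
structure ParametrizesBoundaryComponent (γ : Circle → M) : Prop where
  smooth : ContMDiff (𝓡 1) (𝓡∂ 2) ∞ γ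
  injective : Function.Injective γ
  immersive : ∀ θ, Function.Injective (mfderiv (𝓡 1) (𝓡∂ 2) γ θ)
  range_eq : ∃ x ∈ (𝓡∂ 2).boundary M,
    range γ = connectedComponentIn ((𝓡∂ 2).boundary M) x

/-- The field `n` along `γ` is transverse to `γ`; it represents a coorientation of `γ`. -/
structure IsCoorientation (γ : Circle → M) (n : ∀ θ, TangentSpace (𝓡∂ 2) (γ θ)) : Prop where
  continuous : Continuous fun θ => (⟨γ θ, n θ⟩ : TangentBundle (𝓡∂ 2) M)
  transverse : ∀ θ, n θ ∉ range (mfderiv (𝓡 1) (𝓡∂ 2) γ θ)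

/-- The positive conormal of a cooriented curve: the covectors of `M` at the points of `γ` which
vanish on the tangent of `γ` and are positive on `n`. It is a union of open rays, one over each
point of `γ`; these rays are the points of the Legendrian lift of `γ` to the cosphere bundle
`T^∞M`, the space of open rays of nonzero covectors. -/
def positiveConormal (γ : Circle → M) (n : ∀ θ, TangentSpace (𝓡∂ 2) (γ θ)) :
    Set (CotangentBundle (𝓡∂ 2) M) :=
  {x | ∃ (θ : Circle) (p : TangentSpace (𝓡∂ 2) (γ θ) →L[ℝ] ℝ), x = ⟨γ θ, p⟩ ∧
    (∀ u : TangentSpace (𝓡 1) θ, p (mfderiv (𝓡 1) (𝓡∂ 2) γ θ u) = 0) ∧ 0 < p (n θ)}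

/-- The Legendrian lift of a cooriented curve of `M`, in the ideal boundary of the convex completion.
Over `M` the Liouville flow scales the covectors, so that the cosphere bundle of `M` is contained in
the ideal boundary; a covector of the extended surface at a point of `M` is identified with
its restriction to the tangent space of `M`. -/
def legendrianLift (γ : Circle → M) (n : ∀ θ, TangentSpace (𝓡∂ 2) (γ θ)) :
    Set (IdealBoundary c f) :=
  {y | ∃ z : Escaping c, y = toIdealBoundary c f z ∧
    ∃ (q : M) (p : TangentSpace (𝓡 2) (.ofSurface q : Extension c) →L[ℝ] ℝ),
      z.1 = ⟨.ofSurface q, p⟩ ∧ ⟨q, p.comp (Extension.dInclusion c q)⟩ ∈ positiveConormal γ n}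

end Curves

end Coorientation

/-! ### Smooth coordinates on the ends, and the inclusion of the surface. -/

section

namespace Coorientation
namespace Extension

variable {M : Type*} [TopologicalSpace M] [ChartedSpace (EuclideanHalfSpace 2) M]
  {B : Type*} {c : BoundaryCollar M B}

/-! The boundary component is a circle `r = 0` of some collar, so the covectors that kill its
tangent line are the multiples of `dr`, and its two lifts are the circles of rays of `dr` and of
`-dr`. Over the surface one cannot pass from one to the other through multiples of `dr`, since the
covector would have to vanish, and the zero section there is the skeleton. Over the attached end the
zero section escapes to infinity, because `V ≠ 0` there. In the `(r, ξ)` plane of the covectors `ξ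
dr`, with `r < 1`, only the ray `r ≥ 0`, `ξ = 0` is forbidden, and `(-sin² πt, ε cos πt)` goes
around its tip from `(0, ε)` to `(0, -ε)`.

For fixed `(r, ξ)` the circle of covectors `ξ dr` is Legendrian: `λ_can = ξ dr` vanishes on it
because `r` is constant, and `⟨p, V⟩ = ξ v(r)` is constant, so its differential vanishes too. It is
embedded in the orbit space because the Liouville flow preserves the angle `θ`, which parametrizes
the circle. This is `isLegendrianEmbedding_radialCovector`.

The ends of the isotopy are identified in `range_radialCovector_eq_legendrianLift`: over the surface
the Liouville flow only scales covectors, so its orbits are rays, and a covector in the conormal is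
a multiple of `dr` whose sign is decided by `n`. That sign is the same along the whole component, as
the circle is connected and `dr(n)` has no zero. -/

theorem endChart_mem_charts (b : B) (z : Circle × ℝ) : endChart c b z ∈ charts c :=
  Or.inr ⟨(b, z), rfl⟩

theorem cylMap_mem_endPatch_source (b : B) {z : Circle × ℝ} (hz : z.2 < 1) :
    cylMap c b z ∈ (endPatch c b).source :=
  (endPatch c b).map_target ⟨trivial, hz⟩

theorem endPatch_cylMap (b : B) {z : Circle × ℝ} (hz : z.2 < 1) :
    endPatch c b (cylMap c b z) = z :=
  (endPatch c b).right_inv ⟨trivial, hz⟩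

theorem cylMap_endPatch (b : B) {y : Extension c} (hy : y ∈ (endPatch c b).source) :
    cylMap c b (endPatch c b y) = y :=
  (endPatch c b).left_inv hy

variable [IsManifold (𝓡∂ 2) ∞ M]

/-- The coordinate chart of an end as an open partial homeomorphism. -/
noncomputable def endHomeomorph (b : B) (z : Circle × ℝ) :
    OpenPartialHomeomorph (Extension c) (EuclideanSpace ℝ (Fin 2)) :=
  (chartedSpaceCore c).openPartialHomeomorph (endChart c b z) (endChart_mem_charts b z)

theorem endHomeomorph_mem_atlas (b : B) (z : Circle × ℝ) :
    endHomeomorph b z ∈ atlas (EuclideanSpace ℝ (Fin 2)) (Extension c) :=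
  mem_iUnion₂.2 ⟨endChart c b z, endChart_mem_charts b z, rfl⟩

/-- The topology comes from the charts alone, and the patch is the union of the domains of its
charts, one centred at the image of each point. -/
theorem isOpen_endPatch_source (b : B) : IsOpen (endPatch c b).source := by
  have : (endPatch c b).source = ⋃ z, (endHomeomorph (c := c) b z).source := by
    ext y
    simp only [mem_iUnion]
    constructor
    · intro hy
      refine ⟨endPatch c b y, ?_⟩
      change y ∈ (endChart c b (endPatch c b y)).source
      simp only [endChart, patchChart, PartialEquiv.trans_source,
        Equiv.toPartialEquiv_source, preimage_univ, inter_univ]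
      exact ⟨hy, mem_extChartAt_source (I := cylModel) _⟩
    · rintro ⟨z, hz⟩
      exact hz.1.1
  rw [this]
  exact isOpen_iUnion fun z => (endHomeomorph b z).open_source

theorem contMDiffOn_endPatch (b : B) :
    ContMDiffOn (𝓡 2) cylModel ∞ (endPatch c b) (endPatch c b).source := by
  intro y hy
  set z := endPatch c b y with hz
  have hys : y ∈ (endHomeomorph (c := c) b z).source := by
    change y ∈ (endChart c b z).source
    simp only [endChart, patchChart, PartialEquiv.trans_source,
      Equiv.toPartialEquiv_source, preimage_univ, inter_univ]
    exact ⟨hy, mem_extChartAt_source (I := cylModel) _⟩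
  have h1 : ContMDiffAt (𝓡 2) (𝓡 2) ∞ (endHomeomorph (c := c) b z) y :=
    contMDiffAt_of_mem_maximalAtlas
      (IsManifold.subset_maximalAtlas (endHomeomorph_mem_atlas b z)) hys
  have h2 : ContMDiffAt (𝓡 2) cylModel ∞
      ((extChartAt cylModel z).symm ∘ planeEquiv.symm) (endHomeomorph (c := c) b z y) := by
    have h3 : ContMDiffAt 𝓘(ℝ, EuclideanSpace ℝ (Fin 1) × ℝ) cylModel ∞ (extChartAt cylModel z).symm
        (extChartAt cylModel z z) :=
      (contMDiffOn_extChartAt_symm z).contMDiffAt (by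
        simpa using extChartAt_target_mem_nhds (I := cylModel) z)
    have h4 : ContMDiff (𝓡 2) 𝓘(ℝ, EuclideanSpace ℝ (Fin 1) × ℝ) ∞ planeEquiv.symm :=
      planeEquiv.symm.contDiff.contMDiff
    refine ContMDiffAt.comp _ ?_ h4.contMDiffAt
    convert h3 using 1
    change planeEquiv.symm (planeEquiv (extChartAt cylModel z (endPatch c b y))) = _
    simp [hz]
  refine ((h2.comp y h1).congr_of_eventuallyEq ?_).contMDiffWithinAt
  filter_upwards [(endHomeomorph (c := c) b z).open_source.mem_nhds hys] with w hw
  change _ = (extChartAt cylModel z).symm (planeEquiv.symm (planeEquiv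
    (extChartAt cylModel z (endPatch c b w))))
  rw [planeEquiv.symm_apply_apply, (extChartAt cylModel z).left_inv]
  exact hw.1.2

theorem contMDiffOn_cylMap (b : B) :
    ContMDiffOn cylModel (𝓡 2) ∞ (cylMap c b) (univ ×ˢ Iio (1 : ℝ)) := by
  intro z hz
  have hys : cylMap c b z ∈ (endHomeomorph (c := c) b z).source := by
    change cylMap c b z ∈ (endChart c b z).source
    simp only [endChart, patchChart, PartialEquiv.trans_source,
      Equiv.toPartialEquiv_source, preimage_univ, inter_univ]
    refine ⟨(endPatch c b).map_target hz, ?_⟩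
    change endPatch c b ((endPatch c b).symm z) ∈ (extChartAt cylModel z).source
    rw [(endPatch c b).right_inv hz]
    exact mem_extChartAt_source (I := cylModel) z
  have h1 : ContMDiffAt (𝓡 2) (𝓡 2) ∞ (endHomeomorph (c := c) b z).symm
      (endHomeomorph b z (cylMap c b z)) :=
    contMDiffAt_symm_of_mem_maximalAtlas
      (IsManifold.subset_maximalAtlas (endHomeomorph_mem_atlas b z))
      ((endHomeomorph b z).map_source hys)
  have h2 : ContMDiffAt cylModel (𝓡 2) ∞ (planeEquiv ∘ extChartAt cylModel z) z :=
    ContMDiffAt.comp (I' := 𝓘(ℝ, EuclideanSpace ℝ (Fin 1) × ℝ)) _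
      planeEquiv.contDiff.contMDiff.contMDiffAt contMDiffAt_extChartAt
  have h3 : (planeEquiv ∘ extChartAt cylModel z) z = endHomeomorph b z (cylMap c b z) := by
    change _ = planeEquiv (extChartAt cylModel z (endPatch c b ((endPatch c b).symm z)))
    rw [(endPatch c b).right_inv hz]
    rfl
  rw [← h3] at h1
  refine ((h1.comp z h2).congr_of_eventuallyEq ?_).contMDiffWithinAt
  filter_upwards [extChartAt_source_mem_nhds (I := cylModel) z] with w hw
  change cylMap c b w = cylMap c b ((extChartAt cylModel z).symm (planeEquiv.symm (planeEquiv
    (extChartAt cylModel z w))))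
  rw [planeEquiv.symm_apply_apply, (extChartAt cylModel z).left_inv hw]

/-- On a collar the inclusion is `(c.chart b).symm` followed by `cylMap`; this covers boundary
points, where the interior charts give nothing. -/
theorem contMDiffAt_ofSurface (b : B) {x : M} (hx : x ∈ (c.chart b).target) :
    ContMDiffAt (𝓡∂ 2) (𝓡 2) ∞ (ofSurface : M → Extension c) x := by
  have h1 : ContMDiffAt (𝓡∂ 2) cylModel ∞ (c.chart b).symm x :=
    (c.smooth_symm b).contMDiffAt ((c.isOpen_target b).mem_nhds hx)
  have hs := (c.chart b).map_target hx
  rw [c.source_eq] at hs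
  have h2 : ContMDiffAt cylModel (𝓡 2) ∞ (cylMap c b) ((c.chart b).symm x) :=
    (contMDiffOn_cylMap b).contMDiffAt
      ((isOpen_univ.prod isOpen_Iio).mem_nhds ⟨trivial, hs.2.2⟩)
  refine (h2.comp x h1).congr_of_eventuallyEq ?_
  filter_upwards [(c.isOpen_target b).mem_nhds hx] with w hw
  exact (cylMap_endPatch b (y := ofSurface w) (Or.inl ⟨w, hw, rfl⟩)).symm

/-- Differential of the collar coordinates is injective. -/
theorem injective_mfderiv_chart_symm (b : B) {x : M} (hx : x ∈ (c.chart b).target) :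
    Function.Injective (mfderiv (𝓡∂ 2) cylModel (c.chart b).symm x) := by
  have h1 : MDifferentiableAt (𝓡∂ 2) cylModel (c.chart b).symm x :=
    ((c.smooth_symm b).contMDiffAt ((c.isOpen_target b).mem_nhds hx)).mdifferentiableAt (by simp)
  have hs := (c.chart b).map_target hx
  rw [c.source_eq] at hs
  -- The collar map is smooth only on the half-open cylinder, so it is differentiated within it. Its
  -- composite with the inverse is the identity on the target, which is open in `M`, so the
  -- composite has a full derivative.
  have h2 : MDifferentiableWithinAt cylModel (𝓡∂ 2) (c.chart b) (univ ×ˢ Ico (0 : ℝ) 1)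
      ((c.chart b).symm x) := ((c.smooth b) _ hs).mdifferentiableWithinAt (by simp)
  have h3 : (c.chart b).target ⊆ (c.chart b).symm ⁻¹' (univ ×ˢ Ico (0 : ℝ) 1) := fun w hw => by
    have := (c.chart b).map_target hw
    rwa [c.source_eq] at this
  have h4 := h2.hasMFDerivWithinAt.comp x
    (h1.hasMFDerivAt.hasMFDerivWithinAt (s := (c.chart b).target)) h3
  have h5 := (h4.hasMFDerivAt ((c.isOpen_target b).mem_nhds hx)).congr_of_eventuallyEq
    (f₁ := id) (by
      filter_upwards [(c.isOpen_target b).mem_nhds hx] with w hw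
      exact ((c.chart b).right_inv hw).symm)
  have h6 := hasMFDerivAt_unique h5 (hasMFDerivAt_id x)
  intro u v huv
  have hu : _ = u := congrArg (fun T => T u) h6
  have hv : _ = v := congrArg (fun T => T v) h6
  rw [← hu, ← hv]
  exact congrArg (mfderivWithin cylModel (𝓡∂ 2) (c.chart b) (univ ×ˢ Ico (0 : ℝ) 1)
    ((c.chart b).symm x)) huv

/-- Composed with the end coordinates, the inclusion is the inverse of the collar map, whose
derivative is already injective. -/
theorem injective_dInclusion (b : B) {x : M} (hx : x ∈ (c.chart b).target) :
    Function.Injective (dInclusion c x) := by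
  have h1 : MDifferentiableAt (𝓡∂ 2) (𝓡 2) (ofSurface : M → Extension c) x :=
    (contMDiffAt_ofSurface b hx).mdifferentiableAt (by simp)
  have h2 : MDifferentiableAt (𝓡 2) cylModel (endPatch c b) (ofSurface x) :=
    ((contMDiffOn_endPatch b).contMDiffAt ((isOpen_endPatch_source b).mem_nhds
      (Or.inl ⟨x, hx, rfl⟩))).mdifferentiableAt (by simp)
  have h3 : mfderiv (𝓡∂ 2) cylModel (c.chart b).symm x =
      (mfderiv (𝓡 2) cylModel (endPatch c b) (ofSurface x)).comp (dInclusion c x) :=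
    mfderiv_comp (g := endPatch c b) x h2 h1
  have h4 := injective_mfderiv_chart_symm b hx
  rw [h3] at h4
  exact Function.Injective.of_comp (f := mfderiv (𝓡 2) cylModel (endPatch c b) (ofSurface x)) h4

theorem surjective_dInclusion (b : B) {x : M} (hx : x ∈ (c.chart b).target) :
    Function.Surjective (dInclusion c x) := by
  let A : EuclideanSpace ℝ (Fin 2) →L[ℝ] EuclideanSpace ℝ (Fin 2) := dInclusion c x
  exact LinearMap.surjective_of_injective (f := A.toLinearMap) (injective_dInclusion b hx)

end Extension
end Coorientation

end

/-! ### The coordinates `r` and `θ`, and the Liouville flow over the collars. -/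

section

namespace Coorientation

/-- A smooth multiple of the differential of a smooth function, along a smooth map, is a smooth
family of covectors. -/
theorem contMDiffAt_smul_mfderiv {N : Type*} [TopologicalSpace N]
    [ChartedSpace (EuclideanSpace ℝ (Fin 2)) N] [IsManifold (𝓡 2) ∞ N]
    {E H P : Type*} [NormedAddCommGroup E] [NormedSpace ℝ E] [TopologicalSpace H]
    [TopologicalSpace P] [ChartedSpace H P] {I : ModelWithCorners ℝ E H} [IsManifold I ∞ P]
    {h : N → ℝ} {g : P → N} {s : P → ℝ} {x : P} (hh : ContMDiffAt (𝓡 2) 𝓘(ℝ, ℝ) ∞ h (g x))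
    (hg : ContMDiffAt I (𝓡 2) ∞ g x) (hs : ContMDiffAt I 𝓘(ℝ, ℝ) ∞ s x) :
    ContMDiffAt I cotangentModel ∞
      (fun z => (⟨g z, s z • (mfderiv (𝓡 2) 𝓘(ℝ, ℝ) h (g z) :
        TangentSpace (𝓡 2) (g z) →L[ℝ] ℝ)⟩ : CotangentBundle (𝓡 2) N)) x := by
  refine (contMDiffAt_hom_bundle _).2 ⟨hg, ?_⟩
  have h1 := ContMDiffAt.mfderiv (m := ∞) (x₀ := x) (fun _ => h) g
    (ContMDiffAt.comp (x, g x) hh contMDiffAt_snd) hg le_rfl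
  refine (hs.smul h1).congr_of_eventuallyEq (Filter.Eventually.of_forall fun z => ?_)
  ext u
  -- The covector takes values in the trivial line bundle, the differential in the tangent bundle of
  -- `ℝ`; both trivializations are the identity.
  change ((Bundle.Trivial.trivialization N ℝ).continuousLinearMapAt ℝ (g z))
      ((s z • (mfderiv (𝓡 2) 𝓘(ℝ, ℝ) h (g z) : TangentSpace (𝓡 2) (g z) →L[ℝ] ℝ)) _) =
    s z • ((trivializationAt ℝ (TangentSpace 𝓘(ℝ, ℝ)) (h (g x))).continuousLinearMapAt ℝ (h (g z)))
      ((mfderiv (𝓡 2) 𝓘(ℝ, ℝ) h (g z)) _)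
  rw [TangentBundle.continuousLinearMapAt_model_space]
  rw [Bundle.Trivial.continuousLinearMapAt_trivialization]
  rfl

namespace Extension

variable {M : Type*} [TopologicalSpace M] [ChartedSpace (EuclideanHalfSpace 2) M]
  {B : Type*} {c : BoundaryCollar M B}

variable (c) in
/-- The coordinate `r` near an end. -/
noncomputable def radius (b : B) (y : Extension c) : ℝ := (endPatch c b y).2

variable (c) in
/-- The angular coordinate near an end. -/
noncomputable def angle (b : B) (y : Extension c) : Circle := (endPatch c b y).1

theorem angle_baseFlow (f : EndFlow) (b : B) (t : ℝ) (y : Extension c) :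
    angle c b (baseFlow c f t y) = angle c b y := by
  cases y <;> rfl

theorem radius_baseFlow (f : EndFlow) (b : B) (t : ℝ) {y : Extension c}
    (hy : y ∈ (endPatch c b).source) :
    radius c b (baseFlow c f t y) = f.flow t (radius c b y) := by
  rcases hy with ⟨x, hx, rfl⟩ | ⟨θ, r, rfl⟩
  · have h := (c.chart b).map_target hx
    rw [c.source_eq] at h
    exact (f.fixed t _ h.2.1).symm
  · rfl

theorem baseFlow_mem_endPatch_source (f : EndFlow) (b : B) (t : ℝ) {y : Extension c}
    (hy : y ∈ (endPatch c b).source) : baseFlow c f t y ∈ (endPatch c b).source := by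
  rcases hy with ⟨x, hx, rfl⟩ | ⟨θ, r, rfl⟩
  · exact Or.inl ⟨x, hx, rfl⟩
  · exact Or.inr ⟨θ, _, rfl⟩

variable [IsManifold (𝓡∂ 2) ∞ M]

variable (c) in
/-- The covector `dr` near an end. -/
noncomputable def dRadius (b : B) (y : Extension c) : TangentSpace (𝓡 2) y →L[ℝ] ℝ :=
  mfderiv (𝓡 2) 𝓘(ℝ, ℝ) (radius c b) y

theorem contMDiffAt_radius (b : B) {y : Extension c} (hy : y ∈ (endPatch c b).source) :
    ContMDiffAt (𝓡 2) 𝓘(ℝ, ℝ) ∞ (radius c b) y :=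
  contMDiffAt_snd.comp y
    ((contMDiffOn_endPatch b).contMDiffAt ((isOpen_endPatch_source b).mem_nhds hy))

theorem contMDiffAt_angle (b : B) {y : Extension c} (hy : y ∈ (endPatch c b).source) :
    ContMDiffAt (𝓡 2) (𝓡 1) ∞ (angle c b) y :=
  contMDiffAt_fst.comp y
    ((contMDiffOn_endPatch b).contMDiffAt ((isOpen_endPatch_source b).mem_nhds hy))

theorem contMDiffAt_cylMap (b : B) {z : Circle × ℝ} (hz : z.2 < 1) :
    ContMDiffAt cylModel (𝓡 2) ∞ (cylMap c b) z :=
  (contMDiffOn_cylMap b).contMDiffAt ((isOpen_univ.prod isOpen_Iio).mem_nhds ⟨trivial, hz⟩)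

theorem mdifferentiableAt_baseFlow (f : EndFlow) (b : B) (t : ℝ) {y : Extension c}
    (hy : y ∈ (endPatch c b).source) :
    MDifferentiableAt (𝓡 2) (𝓡 2) (baseFlow c f t) y := by
  have h1 : ContMDiff 𝓘(ℝ, ℝ) 𝓘(ℝ, ℝ) ∞ (f.flow t) :=
    (f.smooth.comp (contDiff_const.prodMk contDiff_id)).contMDiff
  have h2 : ContMDiffAt (𝓡 2) cylModel ∞ (fun w => (angle c b w, f.flow t (radius c b w))) y :=
    (contMDiffAt_angle b hy).prodMk (h1.contMDiffAt.comp y (contMDiffAt_radius b hy))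
  -- The flow preserves the patch, so the flowed radius stays in the range where `cylMap` is smooth.
  have h3 : f.flow t (radius c b y) < 1 := by
    rw [← radius_baseFlow f b t hy]
    exact ((endPatch c b).map_source (baseFlow_mem_endPatch_source f b t hy)).2
  have h4 := (contMDiffAt_cylMap (c := c) b (z := (angle c b y, f.flow t (radius c b y))) h3).comp
    y h2
  refine (h4.congr_of_eventuallyEq ?_).mdifferentiableAt (by simp)
  filter_upwards [(isOpen_endPatch_source b).mem_nhds hy] with w hw
  rw [← cylMap_endPatch b (baseFlow_mem_endPatch_source f b t hw)]
  simp only [Function.comp_apply, ← angle_baseFlow f b t w, ← radius_baseFlow f b t hw]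
  rfl

/-- The flow fixes the surface pointwise. Even at a boundary point, where nearby points of the end
do move, this determines the derivative, because the differential of the inclusion is onto. -/
theorem mfderiv_baseFlow_ofSurface (f : EndFlow) (b : B) (t : ℝ) {x : M}
    (hx : x ∈ (c.chart b).target) :
    mfderiv (𝓡 2) (𝓡 2) (baseFlow c f t) (ofSurface x) =
      ContinuousLinearMap.id ℝ (TangentSpace (𝓡 2) (ofSurface x : Extension c)) := by
  have h1 : dInclusion c x = (mfderiv (𝓡 2) (𝓡 2) (baseFlow c f t) (ofSurface x)).comp
      (dInclusion c x) :=
    mfderiv_comp (g := baseFlow c f t) x (mdifferentiableAt_baseFlow f b t (Or.inl ⟨x, hx, rfl⟩))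
      ((contMDiffAt_ofSurface b hx).mdifferentiableAt (by simp))
  ext1 u
  obtain ⟨w, rfl⟩ := surjective_dInclusion b hx u
  exact (congrArg (fun T => T w) h1).symm

theorem liouvilleFlow_ofSurface (f : EndFlow) (b : B) (t : ℝ) {x : M}
    (hx : x ∈ (c.chart b).target)
    (p : TangentSpace (𝓡 2) (ofSurface x : Extension c) →L[ℝ] ℝ) :
    liouvilleFlow c f t ⟨ofSurface x, p⟩ = ⟨ofSurface x, Real.exp t • p⟩ := by
  have h : p.comp (mfderiv (𝓡 2) (𝓡 2) (baseFlow c f t) (ofSurface x)).inverse = p := by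
    rw [mfderiv_baseFlow_ofSurface f b t hx]
    exact (congrArg p.comp ContinuousLinearMap.inverse_id).trans p.comp_id
  exact congrArg (fun q => (⟨ofSurface x, Real.exp t • q⟩ : Completion c)) h

end Extension
end Coorientation

end

/-! ### Boundary components as collar circles, and the sign of `dr` on a coorientation. -/

section

namespace Coorientation

/-- A functional on the plane which vanishes on a line vanishes on nothing else, unless it is
zero. -/
theorem mem_range_of_apply_eq_zero
    {A : EuclideanSpace ℝ (Fin 1) →ₗ[ℝ] EuclideanSpace ℝ (Fin 2)}
    (hA : Function.Injective A) {α : EuclideanSpace ℝ (Fin 2) →ₗ[ℝ] ℝ} (hα : α ≠ 0)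
    (h : ∀ u, α (A u) = 0) {v : EuclideanSpace ℝ (Fin 2)} (hv : α v = 0) : v ∈ range A := by
  have hle : LinearMap.range A ≤ LinearMap.ker α := by
    rintro _ ⟨u, rfl⟩
    exact h u
  have h1 := LinearMap.finrank_range_of_inj hA
  have h2 := α.finrank_range_add_finrank_ker
  have h3 : LinearMap.range α = ⊤ := LinearMap.range_eq_top.2 (LinearMap.surjective hα)
  rw [h3, finrank_top] at h2
  simp only [Module.finrank_self, finrank_euclideanSpace, Fintype.card_fin] at h1 h2
  -- The image of `A` and the kernel of `α` are both lines: `1` and `2 - 1`.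
  have h4 := Submodule.eq_of_le_of_finrank_le hle (by omega)
  have h5 : v ∈ LinearMap.range A := h4 ▸ hv
  exact h5

/-- Two functionals on the plane which vanish on the same line are proportional. -/
theorem eq_smul_of_apply_eq_zero
    {A : EuclideanSpace ℝ (Fin 1) →ₗ[ℝ] EuclideanSpace ℝ (Fin 2)}
    (hA : Function.Injective A) {α β : EuclideanSpace ℝ (Fin 2) →ₗ[ℝ] ℝ}
    (h : ∀ u, α (A u) = 0) (h' : ∀ u, β (A u) = 0) {n : EuclideanSpace ℝ (Fin 2)}
    (hn : α n ≠ 0) (v : EuclideanSpace ℝ (Fin 2)) : β v = (β n / α n) * α v := by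
  have hα : α ≠ 0 := fun h0 => hn (by simp [h0])
  -- The multiple of `n` is chosen so that `α` kills the difference, which then lies on the common
  -- line and is killed by `β`.
  obtain ⟨u, hu⟩ := mem_range_of_apply_eq_zero hA hα h (v := v - (α v / α n) • n)
    (by simp [hn])
  have := h' u
  rw [hu, map_sub, map_smul, smul_eq_mul, sub_eq_zero] at this
  rw [this]
  ring

/-- A continuous function without zeros on a connected space has a constant sign. -/
theorem exists_sign_of_ne_zero {X : Type*} [TopologicalSpace X] [PreconnectedSpace X] {g : X → ℝ}
    (hg : Continuous g) (h : ∀ x, g x ≠ 0) :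
    ∃ ε : ℝ, (ε = 1 ∨ ε = -1) ∧ ∀ x, 0 < ε * g x := by
  by_cases hp : ∀ x, 0 < g x
  · exact ⟨1, Or.inl rfl, by simpa using hp⟩
  · push Not at hp
    obtain ⟨a, ha⟩ := hp
    refine ⟨-1, Or.inr rfl, fun x => ?_⟩
    by_contra hx
    obtain ⟨y, hy⟩ := mem_range_of_exists_le_of_exists_ge (c := 0) hg ⟨a, ha⟩ ⟨x, by linarith⟩
    exact h y hy

variable {M : Type*} [TopologicalSpace M] [ChartedSpace (EuclideanHalfSpace 2) M]
  {B : Type*} {c : BoundaryCollar M B}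

theorem BoundaryCollar.mem_source (c : BoundaryCollar M B) (b : B) (θ : Circle) :
    (θ, (0 : ℝ)) ∈ (c.chart b).source := by
  rw [c.source_eq]
  exact ⟨trivial, le_rfl, one_pos⟩

theorem mem_target_of_range_eq {γ : Circle → M} {b : B}
    (hb : range γ = range fun θ => c.chart b (θ, 0)) (θ : Circle) : γ θ ∈ (c.chart b).target := by
  obtain ⟨θ', h⟩ := hb ▸ mem_range_self (f := γ) θ
  rw [← h]
  exact (c.chart b).map_source (c.mem_source b θ')

/-- The components of the boundary are the circles `r = 0` of the collars. -/
theorem BoundaryCollar.connectedComponentIn_eq (c : BoundaryCollar M B) {x : M}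
    (hx : x ∈ (𝓡∂ 2).boundary M) :
    ∃ b, connectedComponentIn ((𝓡∂ 2).boundary M) x = range fun θ => c.chart b (θ, 0) := by
  have himage : ∀ b, c.chart b '' (univ ×ˢ {(0 : ℝ)}) = range fun θ => c.chart b (θ, 0) := by
    intro b
    ext y
    constructor
    · rintro ⟨⟨θ, r⟩, ⟨-, hr⟩, rfl⟩
      exact ⟨θ, by rw [show r = 0 from hr]⟩
    · rintro ⟨θ, rfl⟩
      exact ⟨(θ, 0), ⟨trivial, rfl⟩, rfl⟩
  have hboundary : ∀ y, y ∈ (𝓡∂ 2).boundary M ↔ ∃ b θ, c.chart b (θ, 0) = y := fun y => by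
    simp only [c.boundary_eq, mem_iUnion, himage, mem_range]
  obtain ⟨b, θ, rfl⟩ := (hboundary x).1 hx
  refine ⟨b, Subset.antisymm ?_ ?_⟩
  · have hsub : connectedComponentIn ((𝓡∂ 2).boundary M) (c.chart b (θ, 0)) ⊆
        (c.chart b).target := by
      -- The collar of `b` and the union of all other collars are disjoint open sets that cover the
      -- boundary, so a component meeting the first stays in it.
      refine IsPreconnected.subset_left_of_subset_union (c.isOpen_target b)
        (isOpen_biUnion fun b' (_ : b' ∈ {b' | b ≠ b'}) => c.isOpen_target b') ?_ ?_
        ⟨_, mem_connectedComponentIn hx, (c.chart b).map_source (c.mem_source b θ)⟩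
        isPreconnected_connectedComponentIn
      · exact disjoint_iUnion₂_right.2 fun b' hb' => c.disjoint b b' hb'
      · intro y hy
        obtain ⟨b', θ', rfl⟩ := (hboundary y).1 (connectedComponentIn_subset _ _ hy)
        have := (c.chart b').map_source (c.mem_source b' θ')
        by_cases hb : b = b'
        · subst hb
          exact Or.inl this
        · exact Or.inr (mem_iUnion₂.2 ⟨b', hb, this⟩)
    intro y hy
    obtain ⟨b', θ', rfl⟩ := (hboundary y).1 (connectedComponentIn_subset _ _ hy)
    by_cases hb : b = b'
    · subst hb
      exact ⟨θ', rfl⟩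
    · exact ((c.disjoint b b' hb).le_bot
        ⟨hsub hy, (c.chart b').map_source (c.mem_source b' θ')⟩).elim
  · refine IsPreconnected.subset_connectedComponentIn (isPreconnected_range ?_) ⟨θ, rfl⟩ ?_
    · refine continuous_iff_continuousAt.2 fun θ' => ?_
      have h1 := (c.smooth b).continuousOn
      refine (h1.comp_continuous (continuous_id.prodMk continuous_const) fun θ'' => ?_).continuousAt
      rw [← c.source_eq b]
      exact c.mem_source b θ''
    · rintro _ ⟨θ', rfl⟩
      exact (hboundary _).2 ⟨b, θ', rfl⟩

theorem ParametrizesBoundaryComponent.exists_range_eq {γ : Circle → M}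
    (hγ : ParametrizesBoundaryComponent γ) (c : BoundaryCollar M B) :
    ∃ b, range γ = range fun θ => c.chart b (θ, 0) := by
  obtain ⟨x, hx, h⟩ := hγ.range_eq
  rw [h]
  exact c.connectedComponentIn_eq hx

variable [IsManifold (𝓡∂ 2) ∞ M]

namespace Extension

theorem mfderiv_radius_ofSurface (b : B) {x : M} (hx : x ∈ (c.chart b).target) :
    mfderiv (𝓡∂ 2) 𝓘(ℝ, ℝ) (fun x => radius c b (ofSurface x)) x =
      (dRadius c b (ofSurface x)).comp (dInclusion c x) :=
  mfderiv_comp (g := radius c b) x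
    ((contMDiffAt_radius b (Or.inl ⟨x, hx, rfl⟩)).mdifferentiableAt (by simp))
    ((contMDiffAt_ofSurface b hx).mdifferentiableAt (by simp))

/-- Along the curve `s ↦ (θ, s)` the radius is `s`, so `dr` takes the value `1` on its velocity. -/
theorem dRadius_ne_zero (b : B) {y : Extension c} (hy : y ∈ (endPatch c b).source) :
    dRadius c b y ≠ 0 := by
  have hr : (radius c b y) < 1 := ((endPatch c b).map_source hy).2
  have hcurve : ContMDiffAt 𝓘(ℝ, ℝ) (𝓡 2) ∞ (fun s => cylMap c b (angle c b y, s))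
      (radius c b y) :=
    (contMDiffAt_cylMap b (z := (angle c b y, radius c b y)) hr).comp (radius c b y)
      (contMDiffAt_const.prodMk contMDiffAt_id)
  have hy' : cylMap c b (angle c b y, radius c b y) = y := cylMap_endPatch b hy
  have h1 : HasMFDerivAt 𝓘(ℝ, ℝ) 𝓘(ℝ, ℝ)
      (radius c b ∘ fun s => cylMap c b (angle c b y, s)) (radius c b y) _ :=
    HasMFDerivAt.comp (radius c b y) (g := radius c b)
      (by
        rw [hy']
        exact ((contMDiffAt_radius b hy).mdifferentiableAt (by simp)).hasMFDerivAt)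
      (hcurve.mdifferentiableAt (by simp)).hasMFDerivAt
  have h2 := h1.congr_of_eventuallyEq (f₁ := id) (by
    filter_upwards [isOpen_Iio.mem_nhds hr] with s hs
    exact (congrArg Prod.snd (endPatch_cylMap (c := c) b (z := (angle c b y, s)) hs)).symm)
  have h3 := congrArg (fun T => T (1 : ℝ)) (hasMFDerivAt_unique h2 (hasMFDerivAt_id _))
  intro h0
  have h4 : (dRadius c b y) _ = (1 : ℝ) := h3
  rw [h0] at h4
  exact zero_ne_one h4

end Extension

open Extension

variable {γ : Circle → M} (hγ : ParametrizesBoundaryComponent γ)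
include hγ

/-- The radius is identically `0` along `γ`. -/
theorem ParametrizesBoundaryComponent.dRadius_comp {b : B}
    (hb : range γ = range fun θ => c.chart b (θ, 0)) (θ : Circle) (u : TangentSpace (𝓡 1) θ) :
    dRadius c b (ofSurface (γ θ)) (dInclusion c (γ θ) (mfderiv (𝓡 1) (𝓡∂ 2) γ θ u)) = 0 := by
  have hmem : ∀ θ, ∃ θ', c.chart b (θ', 0) = γ θ := fun θ => by
    have : γ θ ∈ range γ := ⟨θ, rfl⟩
    rw [hb] at this
    exact this
  have ht := mem_target_of_range_eq hb
  have h0 : (fun θ => radius c b (ofSurface (γ θ) : Extension c)) = fun _ => 0 := by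
    funext θ
    obtain ⟨θ', h⟩ := hmem θ
    rw [← h]
    exact congrArg Prod.snd ((c.chart b).left_inv (c.mem_source b θ'))
  have hd : MDifferentiableAt (𝓡∂ 2) 𝓘(ℝ, ℝ)
      (fun x => radius c b (ofSurface x : Extension c)) (γ θ) :=
    (((contMDiffAt_radius b (Or.inl ⟨_, ht θ, rfl⟩)).comp (γ θ)
      (contMDiffAt_ofSurface b (ht θ))).mdifferentiableAt (by simp))
  have h1 := mfderiv_comp (g := fun x => radius c b (ofSurface x : Extension c)) θ hd
    (hγ.smooth.mdifferentiableAt (by simp))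
  have h2 : mfderiv (𝓡 1) 𝓘(ℝ, ℝ)
      ((fun x => radius c b (ofSurface x : Extension c)) ∘ γ) θ = 0 := by
    rw [show (fun x => radius c b (ofSurface x : Extension c)) ∘ γ = fun _ => 0 from h0]
    exact mfderiv_const
  rw [h2, mfderiv_radius_ofSurface b (ht θ)] at h1
  exact (congrArg (fun T => T u) h1).symm

/-- `dr(n)` is continuous on the connected circle, and a zero of it would put `n` in the kernel of
`dr`, which is the tangent line of `γ`. -/
theorem ParametrizesBoundaryComponent.exists_sign {b : B}
    (hb : range γ = range fun θ => c.chart b (θ, 0))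
    {n : ∀ θ, TangentSpace (𝓡∂ 2) (γ θ)} (hn : IsCoorientation γ n) :
    ∃ ε : ℝ, (ε = 1 ∨ ε = -1) ∧
      ∀ θ, 0 < ε * dRadius c b (ofSurface (γ θ)) (dInclusion c (γ θ) (n θ)) := by
  have ht := mem_target_of_range_eq hb
  refine exists_sign_of_ne_zero ?_ fun θ h0 => hn.transverse θ ?_
  -- Continuity: `dr(n)` is the fibre component of the tangent map of the radius, taken within the
  -- open collar and applied to the continuous section `n`.
  · have h1 : ContMDiffOn (𝓡∂ 2) 𝓘(ℝ, ℝ) ∞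
        (fun x => radius c b (ofSurface x : Extension c)) (c.chart b).target := fun x hx =>
      ((contMDiffAt_radius b (Or.inl ⟨x, hx, rfl⟩)).comp x
        (contMDiffAt_ofSurface b hx)).contMDiffWithinAt
    have : IsManifold (𝓡∂ 2) 1 M := IsManifold.of_le (n := ∞) (by simp)
    have h2 := h1.continuousOn_tangentMapWithin (by simp) (c.isOpen_target b).uniqueMDiffOn
    have h3 := h2.comp_continuous hn.continuous ht
    have h4 := (contMDiff_snd_tangentBundle_modelSpace (n := 0) ℝ 𝓘(ℝ, ℝ)).continuous.comp h3
    refine h4.congr fun θ => ?_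
    change mfderivWithin (𝓡∂ 2) 𝓘(ℝ, ℝ) (fun x => radius c b (ofSurface x : Extension c))
      (c.chart b).target (γ θ) (n θ) = _
    rw [mfderivWithin_of_isOpen (c.isOpen_target b) (ht θ), mfderiv_radius_ofSurface b (ht θ)]
    rfl
  · let A : EuclideanSpace ℝ (Fin 1) →L[ℝ] EuclideanSpace ℝ (Fin 2) := mfderiv (𝓡 1) (𝓡∂ 2) γ θ
    let α : EuclideanSpace ℝ (Fin 2) →L[ℝ] ℝ :=
      (dRadius c b (ofSurface (γ θ))).comp (dInclusion c (γ θ))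
    refine mem_range_of_apply_eq_zero (A := A.toLinearMap) (α := α.toLinearMap)
      (hγ.immersive θ) (fun hα => ?_) (hγ.dRadius_comp hb θ) h0
    refine dRadius_ne_zero b (Or.inl ⟨γ θ, ht θ, rfl⟩ : (ofSurface (γ θ) : Extension c) ∈ _) ?_
    ext1 u
    obtain ⟨w, rfl⟩ := surjective_dInclusion b (ht θ) u
    exact congrArg (fun T => T w) hα

end Coorientation

end

/-! ### The circles of covectors `ξ dr`, and the isotopy. -/

section

namespace Coorientation

variable {M : Type*} [TopologicalSpace M] [ChartedSpace (EuclideanHalfSpace 2) M]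
  [IsManifold (𝓡∂ 2) ∞ M] {B : Type*} {c : BoundaryCollar M B} {f : EndFlow}

open Extension

theorem baseFlow_zero : baseFlow c f 0 = id := by
  funext y
  cases y with
  | ofSurface x => rfl
  | ofEnd b θ r => exact congrArg (ofEnd b θ) (Subtype.ext (f.flow_zero r))

theorem liouvilleFlow_zero (x : Completion c) : liouvilleFlow c f 0 x = x := by
  -- A general `F` allows the substitution: the covector lives over `F x.proj`, so its type depends
  -- on `F`.
  have key : ∀ F : Extension c → Extension c, F = id →
      (⟨F x.proj, Real.exp 0 • x.2.comp (mfderiv (𝓡 2) (𝓡 2) F x.proj).inverse⟩ : Completion c) =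
        x := by
    rintro _ rfl
    have h : x.2.comp (mfderiv (𝓡 2) (𝓡 2) (id : Extension c → Extension c) x.proj).inverse =
        x.2 := by
      rw [mfderiv_id]
      exact (congrArg x.2.comp ContinuousLinearMap.inverse_id).trans x.2.comp_id
    rw [Real.exp_zero]
    exact congrArg (fun p => (⟨x.proj, p⟩ : Completion c)) ((one_smul ℝ _).trans h)
  exact key _ baseFlow_zero

/-- The angle is constant on Liouville orbits, hence descends to the ideal boundary. -/
theorem angle_eq_of_toIdealBoundary_eq (b : B) {x y : Escaping c}
    (h : toIdealBoundary c f x = toIdealBoundary c f y) :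
    angle c b x.1.proj = angle c b y.1.proj :=
  congrArg (Quot.lift (fun z : Escaping c => angle c b z.1.proj) fun z w ⟨t, ht⟩ => by
    rw [← ht]
    exact (angle_baseFlow f b t z.1.proj).symm) h

/-- The Liouville field has no angular component. -/
theorem mfderiv_angle_liouvilleField (b : B) {x : Completion c}
    (hx : x.proj ∈ (endPatch c b).source) :
    mfderiv cotangentModel (𝓡 1) (fun z : Completion c => angle c b z.proj) x
      (liouvilleField c f x) = 0 := by
  by_cases hd : MDifferentiableAt 𝓘(ℝ, ℝ) cotangentModel (fun t => liouvilleFlow c f t x) 0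
  · have h0 : MDifferentiableAt cotangentModel (𝓡 1) (fun z : Completion c => angle c b z.proj)
        (liouvilleFlow c f 0 x) := by
      rw [liouvilleFlow_zero]
      exact ((contMDiffAt_angle b hx).comp x
        (Bundle.contMDiff_proj _).contMDiffAt).mdifferentiableAt (by simp)
    have h1 := mfderiv_comp (g := fun z : Completion c => angle c b z.proj) 0 h0 hd
    have h2 : (fun z : Completion c => angle c b z.proj) ∘ (fun t => liouvilleFlow c f t x) =
        fun _ => angle c b x.proj := by
      funext t
      exact angle_baseFlow f b t x.proj
    rw [h2, mfderiv_const] at h1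
    have h3 := congrArg (fun T => T (1 : ℝ)) h1
    have key : ∀ w : Completion c, w = x → ∀ v : EuclideanSpace ℝ (Fin 2) ×
        (EuclideanSpace ℝ (Fin 2) →L[ℝ] ℝ),
        (mfderiv cotangentModel (𝓡 1) (fun z : Completion c => angle c b z.proj) w v :
          EuclideanSpace ℝ (Fin 1)) = 0 →
        (mfderiv cotangentModel (𝓡 1) (fun z : Completion c => angle c b z.proj) x v :
          EuclideanSpace ℝ (Fin 1)) = 0 := by
      rintro w rfl v h
      exact h
    exact key _ (liouvilleFlow_zero x) _ h3.symm
  -- Without differentiability in time the derivative has the default value `0`, and the claim is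
  -- trivial; so the regularity of the flow need not be established.
  · have h1 : liouvilleField c f x = 0 := by
      rw [liouvilleField, mfderiv_zero_of_not_mdifferentiableAt hd]
      rfl
    rw [h1, map_zero]

/-- The radial component of `V` is the given field on the line. -/
theorem dRadius_baseField (b : B) {y : Extension c} (hy : y ∈ (endPatch c b).source) :
    dRadius c b y (baseField c f y) = deriv (fun t => f.flow t (radius c b y)) 0 := by
  have hflow : ContMDiff 𝓘(ℝ, ℝ) 𝓘(ℝ, ℝ) ∞ fun t => f.flow t (radius c b y) :=
    (f.smooth.comp (contDiff_id.prodMk contDiff_const)).contMDiff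
  have heq : (fun t => baseFlow c f t y) =
      fun t => cylMap c b (angle c b y, f.flow t (radius c b y)) := by
    funext t
    rw [← cylMap_endPatch b (baseFlow_mem_endPatch_source f b t hy), ← radius_baseFlow f b t hy,
      ← angle_baseFlow f b t y]
    rfl
  have hd : MDifferentiableAt 𝓘(ℝ, ℝ) (𝓡 2) (fun t => baseFlow c f t y) 0 := by
    rw [heq]
    have hlt : f.flow 0 (radius c b y) < 1 := by
      rw [f.flow_zero]
      exact ((endPatch c b).map_source hy).2
    exact ((contMDiffAt_cylMap (c := c) b (z := (angle c b y, f.flow 0 (radius c b y))) hlt).comp 0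
      (contMDiffAt_const.prodMk hflow.contMDiffAt)).mdifferentiableAt (by simp)
  have hy0 : baseFlow c f 0 y = y := congrFun baseFlow_zero y
  have h1 := mfderiv_comp (g := radius c b) 0 ((contMDiffAt_radius b
    (baseFlow_mem_endPatch_source f b 0 hy)).mdifferentiableAt (by simp)) hd
  have h2 : radius c b ∘ (fun t => baseFlow c f t y) = fun t => f.flow t (radius c b y) := by
    funext t
    exact radius_baseFlow f b t hy
  rw [h2, mfderiv_eq_fderiv] at h1
  have h3 := congrArg (fun T => T (1 : ℝ)) h1
  have key : ∀ w : Extension c, w = y → ∀ v : EuclideanSpace ℝ (Fin 2),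
      dRadius c b w v = dRadius c b y v := by
    rintro w rfl v
    rfl
  exact (key _ hy0 _).symm.trans h3.symm

variable (c) in
/-- The point of the completion with coordinates `(θ, r)` and covector `ξ dr`. -/
noncomputable def radialCovector (b : B) (r ξ : ℝ) (θ : Circle) : Completion c :=
  ⟨cylMap c b (θ, r), ξ • dRadius c b (cylMap c b (θ, r))⟩

/-- For `r < 0` the base point is off the surface, so even the zero covector escapes; otherwise the
covector is nonzero because `dr` is. -/
theorem radialCovector_notMem_skeleton (b : B) {r ξ : ℝ} (hr : r < 1) (h : r < 0 ∨ ξ ≠ 0)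
    (θ : Circle) : radialCovector c b r ξ θ ∉ skeleton c := by
  rintro ⟨⟨q, hq⟩, h0⟩
  rcases h with h | h
  · have h1 : cylMap c b (θ, r) = ofEnd b θ ⟨r, h⟩ := dif_pos h
    have h2 : (ofEnd b θ ⟨r, h⟩ : Extension c) = ofSurface q := h1.symm.trans hq
    cases h2
  · exact (smul_ne_zero h (dRadius_ne_zero b (cylMap_mem_endPatch_source b hr))) h0

theorem contMDiffAt_radialCovector {E H P : Type*} [NormedAddCommGroup E] [NormedSpace ℝ E]
    [TopologicalSpace H] [TopologicalSpace P] [ChartedSpace H P] {I : ModelWithCorners ℝ E H}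
    [IsManifold I ∞ P] (b : B) {r ξ : P → ℝ} {θ : P → Circle} {x : P}
    (hr : ContMDiffAt I 𝓘(ℝ, ℝ) ∞ r x) (hξ : ContMDiffAt I 𝓘(ℝ, ℝ) ∞ ξ x)
    (hθ : ContMDiffAt I (𝓡 1) ∞ θ x) (hx : r x < 1) :
    ContMDiffAt I cotangentModel ∞ (fun z => radialCovector c b (r z) (ξ z) (θ z)) x :=
  contMDiffAt_smul_mfderiv
    (contMDiffAt_radius b (cylMap_mem_endPatch_source b (z := (θ x, r x)) hx))
    ((contMDiffAt_cylMap b (z := (θ x, r x)) hx).comp x (hθ.prodMk hr)) hξ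

/-- The circle of the covectors `ξ dr` over a circle `r = const` of an end. -/
theorem isLegendrianEmbedding_radialCovector (b : B) {r ξ : ℝ} (hr : r < 1)
    (h : ∀ θ, radialCovector c b r ξ θ ∉ skeleton c) :
    IsLegendrianEmbedding c f fun θ => ⟨radialCovector c b r ξ θ, h θ⟩ := by
  have hsmooth : ContMDiff (𝓡 1) cotangentModel ∞ (radialCovector c b r ξ) := fun θ =>
    contMDiffAt_radialCovector (θ := id) b contMDiffAt_const contMDiffAt_const contMDiffAt_id hr
  have hsource : ∀ θ, cylMap c b (θ, r) ∈ (endPatch c b).source := fun θ =>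
    cylMap_mem_endPatch_source b hr
  have hangle : ∀ θ, angle c b (cylMap c b (θ, r)) = θ := fun θ =>
    congrArg Prod.fst (endPatch_cylMap (c := c) b (z := (θ, r)) hr)
  have hradius : ∀ θ, radius c b (cylMap c b (θ, r)) = r := fun θ =>
    congrArg Prod.snd (endPatch_cylMap (c := c) b (z := (θ, r)) hr)
  have hproj : ∀ x : Completion c, MDifferentiableAt cotangentModel (𝓡 2)
      (Bundle.TotalSpace.proj : Completion c → Extension c) x := fun x =>
    (Bundle.contMDiff_proj (n := ∞) _).mdifferentiableAt (by simp)
  refine ⟨hsmooth, fun θ θ' hθ => ?_, fun θ u a hu => ?_, fun θ u => ?_⟩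
  · have := angle_eq_of_toIdealBoundary_eq b hθ
    exact (hangle θ).symm.trans (this.trans (hangle θ'))
  -- The differential of the angle is the identity on the circle and kills the Liouville field, so a
  -- tangent vector proportional to that field is `0`.
  · have hd : MDifferentiableAt cotangentModel (𝓡 1) (fun z : Completion c => angle c b z.proj)
        (radialCovector c b r ξ θ) :=
      (ContMDiffAt.comp (radialCovector c b r ξ θ) (g := angle c b)
        (contMDiffAt_angle b (hsource θ)) (Bundle.contMDiff_proj _).contMDiffAt).mdifferentiableAt (by simp)
    have h1 := mfderiv_comp (g := fun z : Completion c => angle c b z.proj) θ hd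
      (hsmooth.mdifferentiableAt (by simp))
    rw [show (fun z : Completion c => angle c b z.proj) ∘ radialCovector c b r ξ = id from
      funext hangle, mfderiv_id] at h1
    have h2 : u = mfderiv cotangentModel (𝓡 1) (fun z : Completion c => angle c b z.proj)
        (radialCovector c b r ξ θ) (mfderiv (𝓡 1) cotangentModel (radialCovector c b r ξ) θ u) :=
      congrArg (fun T => T u) h1
    have h3 := mfderiv_angle_liouvilleField (f := f) b (x := radialCovector c b r ξ θ) (hsource θ)
    have h4 := congrArg (mfderiv cotangentModel (𝓡 1)
      (fun z : Completion c => angle c b z.proj) (radialCovector c b r ξ θ)) hu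
    rw [map_smul, h3, smul_zero] at h4
    exact h2.trans h4
  -- At these points `λ_can` is `ξ` times the pullback of `dr`, and `r` is constant on the circle.
  · have h1 : canonicalForm c (radialCovector c b r ξ θ)
        (mfderiv (𝓡 1) cotangentModel (radialCovector c b r ξ) θ u) = 0 := by
      have h2 := mfderiv_comp (g := fun z : Completion c => radius c b z.proj) θ
        (MDifferentiableAt.comp (radialCovector c b r ξ θ) (g := radius c b)
          ((contMDiffAt_radius b (hsource θ)).mdifferentiableAt (by simp))
          (hproj (radialCovector c b r ξ θ)))
        (hsmooth.mdifferentiableAt (by simp))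
      rw [show (fun z : Completion c => radius c b z.proj) ∘ radialCovector c b r ξ = fun _ => r
        from funext hradius, mfderiv_const] at h2
      have h3 := mfderiv_comp (g := radius c b) (radialCovector c b r ξ θ)
        ((contMDiffAt_radius b (hsource θ)).mdifferentiableAt (by simp))
        (hproj (radialCovector c b r ξ θ))
      have h4 := congrArg (fun T => T u) h2
      change (0 : ℝ) = mfderiv cotangentModel 𝓘(ℝ, ℝ) (radius c b ∘ Bundle.TotalSpace.proj)
        (radialCovector c b r ξ θ)
        (mfderiv (𝓡 1) cotangentModel (radialCovector c b r ξ) θ u) at h4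
      rw [h3] at h4
      change ξ • _ = (0 : ℝ)
      exact (congrArg (fun s : ℝ => ξ • s) h4.symm).trans (smul_zero ξ)
    have h2 : dMomentum c f (radialCovector c b r ξ θ)
        (mfderiv (𝓡 1) cotangentModel (radialCovector c b r ξ) θ u) = 0 := by
      -- On the circle the momentum is the constant `ξ v(r)`. If the momentum is not differentiable
      -- at the point, its differential is `0` by default, so smoothness of `V` is not needed.
      by_cases hd : MDifferentiableAt cotangentModel 𝓘(ℝ, ℝ) (momentum c f)
        (radialCovector c b r ξ θ)
      · have h3 := mfderiv_comp (g := momentum c f) θ hd (hsmooth.mdifferentiableAt (by simp))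
        have h4 : momentum c f ∘ radialCovector c b r ξ =
            fun _ => ξ * deriv (fun t => f.flow t r) 0 := by
          funext θ'
          have h5 := dRadius_baseField (f := f) b (hsource θ')
          rw [hradius] at h5
          exact congrArg (fun s => ξ * s) h5
        rw [h4, mfderiv_const] at h3
        exact (congrArg (fun T => T u) h3).symm
      · rw [dMomentum, mfderiv_zero_of_not_mdifferentiableAt hd]
        rfl
    change canonicalForm c _ _ - dMomentum c f _ _ = 0
    exact (congrArg₂ (fun s t : ℝ => s - t) h1 h2).trans (sub_zero 0)

/-- The Legendrian lift of a boundary component consists of the rays of `ε dr`. -/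
theorem range_radialCovector_eq_legendrianLift {γ : Circle → M}
    (hγ : ParametrizesBoundaryComponent γ) {b : B}
    (hb : range γ = range fun θ => c.chart b (θ, 0)) {n : ∀ θ, TangentSpace (𝓡∂ 2) (γ θ)}
    {ε : ℝ} (hε : ∀ θ, 0 < ε * dRadius c b (ofSurface (γ θ)) (dInclusion c (γ θ) (n θ)))
    (h : ∀ θ, radialCovector c b 0 ε θ ∉ skeleton c) :
    range (fun θ => toIdealBoundary c f ⟨radialCovector c b 0 ε θ, h θ⟩) =
      legendrianLift c f γ n := by
  have hcyl : ∀ θ, cylMap c b (θ, 0) = ofSurface (c.chart b (θ, 0)) := fun θ =>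
    dif_neg (lt_irrefl _)
  have hpoint : ∀ θ, radialCovector c b 0 ε θ = ⟨ofSurface (c.chart b (θ, 0)),
      ε • dRadius c b (ofSurface (c.chart b (θ, 0)))⟩ := fun θ =>
    congrArg (fun y => (⟨y, ε • dRadius c b y⟩ : Completion c)) (hcyl θ)
  ext y
  constructor
  · rintro ⟨θ, rfl⟩
    refine ⟨_, rfl, c.chart b (θ, 0), _, hpoint θ, ?_⟩
    obtain ⟨θ', h'⟩ : c.chart b (θ, 0) ∈ range γ := hb ▸ ⟨θ, rfl⟩
    rw [← h']
    refine ⟨θ', _, rfl, fun u => ?_, hε θ'⟩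
    exact (congrArg (fun s : ℝ => ε • s) (hγ.dRadius_comp hb θ' u)).trans (smul_zero ε)
  · rintro ⟨z, rfl, q, p, hz, θ, p', hp, hker, hpos⟩
    obtain rfl : q = γ θ := congrArg Bundle.TotalSpace.proj hp
    obtain rfl : p.comp (dInclusion c (γ θ)) = p' := by simpa using hp
    obtain ⟨θ', h'⟩ : γ θ ∈ range fun θ => c.chart b (θ, 0) := hb ▸ mem_range_self (f := γ) θ
    have ht := mem_target_of_range_eq hb θ
    set β := dRadius c b (ofSurface (γ θ) : Extension c) with hβ
    have hne : β (dInclusion c (γ θ) (n θ)) ≠ 0 := fun h0 => by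
      have := hε θ
      rw [h0, mul_zero] at this
      exact lt_irrefl _ this
    -- Both `p` and `β = dr` kill the tangent of `γ`, so they are proportional; evaluating on `n`
    -- gives the factor.
    set k := p (dInclusion c (γ θ) (n θ)) / β (dInclusion c (γ θ) (n θ)) with hk
    have hpk : p = k • β := by
      ext1 v
      obtain ⟨w, rfl⟩ := surjective_dInclusion b ht v
      let A : EuclideanSpace ℝ (Fin 1) →L[ℝ] EuclideanSpace ℝ (Fin 2) := mfderiv (𝓡 1) (𝓡∂ 2) γ θ
      let α : EuclideanSpace ℝ (Fin 2) →L[ℝ] ℝ := β.comp (dInclusion c (γ θ))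
      let α' : EuclideanSpace ℝ (Fin 2) →L[ℝ] ℝ := p.comp (dInclusion c (γ θ))
      exact eq_smul_of_apply_eq_zero (A := A.toLinearMap) (α := α.toLinearMap)
        (β := α'.toLinearMap) (hγ.immersive θ) (hγ.dRadius_comp hb θ) hker hne w
    have hkε : 0 < k / ε := by
      have h1 := hε θ
      have hpos' : 0 < p (dInclusion c (γ θ) (n θ)) := hpos
      rw [hk, div_div, mul_comm]
      exact div_pos hpos' h1
    have hε0 : ε ≠ 0 := fun h0 => by simp [h0] at hkε
    -- The flow scales by `exp t`, and this time takes `ε dr` to `k dr`.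
    refine ⟨θ', Quot.sound ⟨Real.log (k / ε), ?_⟩⟩
    change liouvilleFlow c f _ (radialCovector c b 0 ε θ') = z.1
    rw [hpoint θ', liouvilleFlow_ofSurface f b _ ((c.chart b).map_source (c.mem_source b θ')), hz,
      show c.chart b (θ', 0) = γ θ from h', hpk, Real.exp_log hkε, smul_smul,
      div_mul_cancel₀ _ hε0]

/-- The two Legendrian lifts of a boundary component are isotopic through the covectors over the
attached end. -/
theorem legendrianIsotopic_legendrianLift {γ : Circle → M}
    (hγ : ParametrizesBoundaryComponent γ) {n : ∀ θ, TangentSpace (𝓡∂ 2) (γ θ)}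
    (hn : IsCoorientation γ n) :
    LegendrianIsotopic c f (legendrianLift c f γ n) (legendrianLift c f γ fun θ => -n θ) := by
  obtain ⟨b, hb⟩ := hγ.exists_range_eq c
  obtain ⟨ε, hε1, hε⟩ := hγ.exists_sign hb hn
  have hε0 : ε ≠ 0 := by rcases hε1 with rfl | rfl <;> norm_num
  -- As `ε = ±1`, this is an arc of the parabola `r = ξ² - 1`: it starts and ends on `r = 0` with
  -- opposite values of `ξ`, and crosses `ξ = 0` at `r = -1`, over the end.
  let r : ℝ → ℝ := fun t => -Real.sin (Real.pi * t) ^ 2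
  let ξ : ℝ → ℝ := fun t => ε * Real.cos (Real.pi * t)
  have hr : ∀ t, r t < 1 := fun t =>
    lt_of_le_of_lt (neg_nonpos.2 (sq_nonneg (Real.sin (Real.pi * t)))) one_pos
  have hrξ : ∀ t, r t < 0 ∨ ξ t ≠ 0 := fun t => by
    by_cases h : Real.sin (Real.pi * t) = 0
    · refine Or.inr (mul_ne_zero hε0 fun h' => ?_)
      have := Real.sin_sq_add_cos_sq (Real.pi * t)
      simp [h, h'] at this
    · exact Or.inl (neg_lt_zero.2 (by positivity))
  have hrs : ContDiff ℝ ∞ r := (Real.contDiff_sin.comp (contDiff_const.mul contDiff_id)).pow 2 |>.neg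
  have hξs : ContDiff ℝ ∞ ξ :=
    contDiff_const.mul (Real.contDiff_cos.comp (contDiff_const.mul contDiff_id))
  have hesc : ∀ t θ, radialCovector c b (r t) (ξ t) θ ∉ skeleton c := fun t =>
    radialCovector_notMem_skeleton b (hr t) (hrξ t)
  have hend : ∀ (t s : ℝ), r t = 0 → ξ t = s → ∀ (n' : ∀ θ, TangentSpace (𝓡∂ 2) (γ θ)),
      (∀ θ, 0 < s * dRadius c b (.ofSurface (γ θ)) (Extension.dInclusion c (γ θ) (n' θ))) →
      range (fun θ => toIdealBoundary c f ⟨radialCovector c b (r t) (ξ t) θ, hesc t θ⟩) =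
        legendrianLift c f γ n' := by
    intro t s h1 h2 n' h3
    have key : ∀ r' ξ', r' = 0 → ξ' = s → ∀ h : ∀ θ, radialCovector c b r' ξ' θ ∉ skeleton c,
        range (fun θ => toIdealBoundary c f ⟨radialCovector c b r' ξ' θ, h θ⟩) =
          legendrianLift c f γ n' := by
      rintro _ _ rfl rfl h
      exact range_radialCovector_eq_legendrianLift hγ hb h3 h
    exact key _ _ h1 h2 _
  refine ⟨fun z => ⟨radialCovector c b (r z.1) (ξ z.1) z.2, hesc z.1 z.2⟩, ?_, ?_, ?_, ?_⟩
  · exact fun z _ => (contMDiffAt_radialCovector b (hrs.contMDiff.contMDiffAt.comp z contMDiffAt_fst)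
      (hξs.contMDiff.contMDiffAt.comp z contMDiffAt_fst) contMDiffAt_snd (hr z.1)).contMDiffWithinAt
  · exact fun t _ => isLegendrianEmbedding_radialCovector b (hr t) (hesc t)
  · exact hend 0 ε (by simp [r]) (by simp [ξ]) n hε
  -- Reversing both the covector and the coorientation leaves the positivity condition unchanged.
  · refine hend 1 (-ε) (by simp [r]) (by simp [ξ]) _ fun θ => ?_
    have h1 : Extension.dInclusion c (γ θ) (-n θ) = -Extension.dInclusion c (γ θ) (n θ) :=
      map_neg _ _
    rw [h1, map_neg, neg_mul_neg]
    exact hε θ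

end Coorientation

end

theorem mainTheorem7 {M : Type*} [TopologicalSpace M] [T2Space M] [SecondCountableTopology M]
    [ChartedSpace (EuclideanHalfSpace 2) M] [IsManifold (𝓡∂ 2) ∞ M]
    {B : Type*} (c : Coorientation.BoundaryCollar M B) (f : Coorientation.EndFlow)
    (γ : Circle → M) (hγ : Coorientation.ParametrizesBoundaryComponent γ)
    (n : ∀ θ, TangentSpace (𝓡∂ 2) (γ θ)) (hn : Coorientation.IsCoorientation γ n) :
    Coorientation.LegendrianIsotopic c f
      (Coorientation.legendrianLift c f γ n)
      (Coorientation.legendrianLift c f γ (fun θ => -n θ)) :=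
  Coorientation.legendrianIsotopic_legendrianLift hγ hn
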